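/- Let $\mathcal{M}\subset B(\mathcal{H})$ be a von Neumann algebra on a complex Hilbert space $\mathcal{H}$, and let $\mathcal{M}_*$ be its predual, that is, the space of ultraweakly (weak-*) continuous linear forms on $\mathcal{M}$, with the norm of the dual of $\mathcal{M}$ and with the order for which $\psi\ge\varphi$ means $(\psi-\varphi)(x^*x)\ge 0$ for all $x\in\mathcal{M}$. Let $n\ge 1$ and let $\varphi_1,\dots,\varphi_n\in\mathcal{M}_*$ be positive. Then, among the elements $\psi\in\mathcal{M}_*$ such that $\psi\ge\varphi_i$ for all $i$, there is a unique one of minimal norm. Moreover, for this $\psi$ there is a POVM $(t_1,\dots,t_n)$ in $\mathcal{M}$, that is, positive operators $t_1,\dots,t_n\in\mathcal{M}$ with $\sum_{i=1}^n t_i=1$, such that $\psi=\sum_{i=1}^n t_i\varphi_i$, where $t\varphi$ denotes the linear form $x\mapsto\varphi(xt)$. -/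

import Mathlib

open scoped ComplexOrder Topology

noncomputable section

namespace VonNeumannAlgebra

variable {H : Type*} [NormedAddCommGroup H] [InnerProductSpace ℂ H] [CompleteSpace H]

/-- The ultraweak (that is, weak-*) topology on a von Neumann algebra `M ⊆ B(H)`: the smallest
topology making continuous all the maps `x ↦ ∑ₖ ⟨x ξₖ, ηₖ⟩`, for sequences `ξₖ, ηₖ` in `H` with
`∑ₖ ‖ξₖ‖ ‖ηₖ‖ < ∞`. (Mathlib's inner product is linear in its second argument.) -/
@[reducible] def ultraweakTopology (M : VonNeumannAlgebra H) : TopologicalSpace M.toStarSubalgebra :=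
  ⨅ (ξ : ℕ → H) (η : ℕ → H) (_ : Summable fun k => ‖ξ k‖ * ‖η k‖),
    TopologicalSpace.induced
      (fun x : M.toStarSubalgebra => ∑' k, inner ℂ (η k) ((x : H →L[ℂ] H) (ξ k)))
      inferInstance

/-- The predual `M_*`: the space of the ultraweakly continuous linear forms on `M`, with the norm
of the dual Banach space of `M`. (The ultraweak topology is coarser than the norm topology, so
all such linear forms are bounded.) -/
def predual (M : VonNeumannAlgebra H) : Submodule ℂ (StrongDual ℂ M.toStarSubalgebra) where
  carrier := {φ | Continuous[M.ultraweakTopology, inferInstance] φ}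
  add_mem' {_ _} hφ hψ := by
    let _ := M.ultraweakTopology
    exact Continuous.add (X := M.toStarSubalgebra) hφ hψ
  zero_mem' := by
    let _ := M.ultraweakTopology
    exact continuous_const (X := M.toStarSubalgebra)
  smul_mem' c _ hφ := by
    let _ := M.ultraweakTopology
    exact Continuous.mul (X := M.toStarSubalgebra) (continuous_const (y := c)) hφ

/-- A linear form `φ` on `M` is positive if `φ (x* x) ≥ 0` (real and nonnegative) for all `x`. -/
def IsPositiveForm {M : VonNeumannAlgebra H} (φ : M.predual) : Prop :=
  ∀ x : M.toStarSubalgebra, 0 ≤ (φ : StrongDual ℂ M.toStarSubalgebra) (star x * x)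

/-- `ψ ≥ φᵢ` for all `i`, in the order of `M_*`: all the differences `ψ - φᵢ` are positive. -/
def IsMajorant {M : VonNeumannAlgebra H} {n : ℕ} (φ : Fin n → M.predual) (ψ : M.predual) : Prop :=
  ∀ i, IsPositiveForm (ψ - φ i)

/-- `ψ` has minimal norm among the elements of `M_*` that majorize all the `φᵢ`. -/
def IsMinimalMajorant {M : VonNeumannAlgebra H} {n : ℕ} (φ : Fin n → M.predual)
    (ψ : M.predual) : Prop :=
  IsMajorant φ ψ ∧ ∀ ψ' : M.predual, IsMajorant φ ψ' → ‖ψ‖ ≤ ‖ψ'‖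

/-- A POVM in `M`: positive operators in `M` that sum to the identity. -/
def IsPOVM {M : VonNeumannAlgebra H} {n : ℕ} (t : Fin n → M.toStarSubalgebra) : Prop :=
  (∀ i, (t i : H →L[ℂ] H).IsPositive) ∧ ∑ i, t i = 1

theorem continuous_mul_right_ultraweak (M : VonNeumannAlgebra H) (t : M.toStarSubalgebra) :
    Continuous[M.ultraweakTopology, M.ultraweakTopology] fun x => x * t := by
  unfold ultraweakTopology
  refine continuous_iInf_rng.2 fun ξ => continuous_iInf_rng.2 fun η =>
    continuous_iInf_rng.2 fun h => continuous_induced_rng.2 ?_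
  have h' : Summable fun k => ‖(t : H →L[ℂ] H) (ξ k)‖ * ‖η k‖ := by
    refine Summable.of_nonneg_of_le (fun k => by positivity) (fun k => ?_)
      (h.mul_left ‖(t : H →L[ℂ] H)‖)
    rw [← mul_assoc]
    exact mul_le_mul_of_nonneg_right ((t : H →L[ℂ] H).le_opNorm _) (norm_nonneg _)
  exact continuous_iInf_dom (i := fun k => (t : H →L[ℂ] H) (ξ k)) <|
    continuous_iInf_dom (i := η) <| continuous_iInf_dom (i := h') continuous_induced_dom

/-- For `t ∈ M` and `φ ∈ M_*`, the form `t φ ∈ M_*` given by `x ↦ φ (x t)`. -/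
def lmul {M : VonNeumannAlgebra H} (t : M.toStarSubalgebra) (φ : M.predual) : M.predual :=
  ⟨(φ : StrongDual ℂ M.toStarSubalgebra).comp
      ((ContinuousLinearMap.mul ℂ M.toStarSubalgebra).flip t), by
    have hφ : Continuous[M.ultraweakTopology, inferInstance]
        (φ : StrongDual ℂ M.toStarSubalgebra) := φ.2
    have h : Continuous[M.ultraweakTopology, inferInstance]
        ((φ : StrongDual ℂ M.toStarSubalgebra) ∘ fun x => x * t) :=
      @Continuous.comp _ _ _ M.ultraweakTopology M.ultraweakTopology _ _ _ hφ
        (M.continuous_mul_right_ultraweak t)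
    exact h⟩

end VonNeumannAlgebra

end

/-!
The theorem is an instance of semidefinite duality. For a majorant `ψ` and a POVM `t`,
`ψ(1) - ∑ᵢ φᵢ(tᵢ) = ∑ᵢ (ψ - φᵢ)(tᵢ) ≥ 0`, while a majorant is positive and hence has norm `ψ(1)`.
So minimizing `‖ψ‖` is dual to maximizing `∑ᵢ φᵢ(tᵢ)` over the POVMs of `M`.

A maximizing POVM exists by compactness (`IsPOVM.exists_isMax`): along an ultrafilter, POVMs
converge in the weak operator topology, the bicommutant property keeps the limit in `M`, and
ultraweakly continuous forms converge on bounded weakly convergent families.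

For a maximizing `t`, the form `∑ᵢ tᵢ φᵢ` is a majorant (`isMajorant_sum_lmul`). This is the
first-order optimality condition for the perturbations `t'ᵢ = w* tᵢ w + δᵢⱼ (1 - w* w)`, where
`w = 1 - ε (1 + i κ) x* x`. The value of this majorant at `1` is `∑ᵢ φᵢ(tᵢ)`, so its norm is minimal.

Conversely, any minimal majorant `ψ` attains equality in the duality, so every positive form
`ψ - φᵢ` vanishes at `tᵢ`. By Cauchy–Schwarz (`IsPositiveForm.apply_mul_eq_zero`), it then vanishes
at `x tᵢ` for all `x`, and summing over `i` gives `ψ(x) = ∑ᵢ φᵢ(x tᵢ)`.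
-/

open Filter

/-! ### Positive forms on star algebras -/

section PositiveForms

variable {A : Type*} [Ring A] [StarRing A] [Algebra ℂ A] [StarModule ℂ A]

theorem LinearMap.map_star_of_map_star_mul_self_nonneg (f : A →ₗ[ℂ] ℂ)
    (hf : ∀ x, 0 ≤ f (star x * x)) (x : A) : f (star x) = star (f x) := by
  have expand (c : ℂ) : f (star (x + c • 1) * (x + c • 1)) =
      f (star x * x) + c * f (star x) + star c * f x + star c * c * f 1 := by
    simp [add_mul, mul_add, smul_smul, mul_assoc]
    ring
  have him (y : A) : (f (star y * y)).im = 0 := (Complex.nonneg_iff.1 (hf y)).2.symm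
  have h0 := him 1
  have hx := him x
  have h1 := him (x + (1 : ℂ) • 1)
  have hI := him (x + Complex.I • 1)
  rw [expand] at h1 hI
  simp only [star_one, mul_one] at h0
  simp [hx, h0] at h1 hI
  apply Complex.ext <;> simp <;> linarith

/-- The Cauchy–Schwarz inequality for the positive semidefinite form `(x, y) ↦ f (x* y)`. -/
theorem LinearMap.norm_map_star_mul_sq_le (f : A →ₗ[ℂ] ℂ)
    (hf : ∀ x, 0 ≤ f (star x * x)) (x y : A) :
    ‖f (star x * y)‖ ^ 2 ≤ (f (star x * x)).re * (f (star y * y)).re := by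
  have hs := f.map_star_of_map_star_mul_self_nonneg hf
  let c : PreInnerProductSpace.Core ℂ A :=
    { inner := fun x y => f (star x * y)
      conj_inner_symm := fun x y => by
        have := hs (star y * x)
        simp only [star_mul, star_star] at this
        exact this.symm
      re_inner_nonneg := fun x => (Complex.nonneg_iff.1 (hf x)).1
      add_left := fun x y z => by simp [add_mul]
      smul_left := fun x y r => by simp }
  have h : ‖f (star x * y)‖ * ‖f (star y * x)‖ ≤ (f (star x * x)).re * (f (star y * y)).re :=
    @InnerProductSpace.Core.inner_mul_inner_self_le ℂ A _ _ _ c x y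
  have h' : ‖f (star y * x)‖ = ‖f (star x * y)‖ := by
    have := hs (star x * y)
    simp only [star_mul, star_star] at this
    rw [this, norm_star]
  rwa [h', ← sq] at h

end PositiveForms

namespace VonNeumannAlgebra

variable {H : Type*} [NormedAddCommGroup H] [InnerProductSpace ℂ H] [CompleteSpace H]

/-! ### Positive operators and positive forms on a von Neumann algebra -/

theorem mem_of_forall_commute (M : VonNeumannAlgebra H) {a : H →L[ℂ] H}
    (h : ∀ y ∈ M.commutant, y * a = a * y) : a ∈ M.toStarSubalgebra := by
  have : a ∈ M := by
    rw [← M.commutant_commutant]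
    exact mem_commutant_iff.2 h
  exact this

/-- A positive operator of `M` is a square `s* s` within `M`: its square root commutes with the
commutant of `M`, hence lies in the bicommutant. -/
theorem exists_star_mul_self_eq {M : VonNeumannAlgebra H} (t : M.toStarSubalgebra)
    (ht : (t : H →L[ℂ] H).IsPositive) : ∃ s : M.toStarSubalgebra, star s * s = t := by
  have h0 : 0 ≤ (t : H →L[ℂ] H) := (ContinuousLinearMap.nonneg_iff_isPositive _).2 ht
  have hmem : CFC.sqrt (t : H →L[ℂ] H) ∈ M.toStarSubalgebra := by
    refine M.mem_of_forall_commute fun y hy => ?_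
    have hc : Commute (t : H →L[ℂ] H) y := mem_commutant_iff.1 hy t t.2
    exact (hc.cfcₙ_nnreal NNReal.sqrt).symm
  refine ⟨⟨_, hmem⟩, Subtype.ext ?_⟩
  change star (CFC.sqrt (t : H →L[ℂ] H)) * CFC.sqrt (t : H →L[ℂ] H) = t
  rw [(IsSelfAdjoint.of_nonneg (CFC.sqrt_nonneg (t : H →L[ℂ] H))).star_eq,
    CFC.sqrt_mul_sqrt_self _ h0]

theorem isPositive_star_mul_self {M : VonNeumannAlgebra H} (x : M.toStarSubalgebra) :
    ((star x * x : M.toStarSubalgebra) : H →L[ℂ] H).IsPositive :=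
  ContinuousLinearMap.isPositive_adjoint_comp_self (x : H →L[ℂ] H)

theorem isPositive_one_sub_star_mul_self {M : VonNeumannAlgebra H} (w : M.toStarSubalgebra)
    (hw : ‖w‖ ≤ 1) : ((1 - star w * w : M.toStarSubalgebra) : H →L[ℂ] H).IsPositive := by
  have h0 := (ContinuousLinearMap.nonneg_iff_isPositive _).2 (isPositive_star_mul_self w)
  have h1 : ‖((star w * w : M.toStarSubalgebra) : H →L[ℂ] H)‖ ≤ 1 := by
    have : ‖star (w : H →L[ℂ] H) * (w : H →L[ℂ] H)‖ ≤ 1 := by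
      rw [CStarRing.norm_star_mul_self]
      exact mul_le_one₀ hw (norm_nonneg _) hw
    exact this
  exact (ContinuousLinearMap.le_def _ _).1 ((CStarAlgebra.norm_le_one_iff_of_nonneg _ h0).1 h1)

namespace IsPositiveForm

variable {M : VonNeumannAlgebra H} {φ : M.predual}

theorem apply_nonneg (hφ : IsPositiveForm φ) {t : M.toStarSubalgebra}
    (ht : (t : H →L[ℂ] H).IsPositive) : 0 ≤ (φ : StrongDual ℂ M.toStarSubalgebra) t := by
  obtain ⟨s, rfl⟩ := exists_star_mul_self_eq t ht
  exact hφ s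

theorem map_star (hφ : IsPositiveForm φ) (x : M.toStarSubalgebra) :
    (φ : StrongDual ℂ M.toStarSubalgebra) (star x) =
      star ((φ : StrongDual ℂ M.toStarSubalgebra) x) :=
  (φ : StrongDual ℂ M.toStarSubalgebra).toLinearMap.map_star_of_map_star_mul_self_nonneg hφ x

/-- If a positive form vanishes at a positive operator `t = s* s`, then it vanishes at `x t` for
all `x`, by the Cauchy–Schwarz inequality applied to `x t = (s x*)* s`. -/
theorem apply_mul_eq_zero (hφ : IsPositiveForm φ) {t : M.toStarSubalgebra}
    (ht : (t : H →L[ℂ] H).IsPositive) (h : (φ : StrongDual ℂ M.toStarSubalgebra) t = 0)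
    (x : M.toStarSubalgebra) : (φ : StrongDual ℂ M.toStarSubalgebra) (x * t) = 0 := by
  obtain ⟨s, rfl⟩ := exists_star_mul_self_eq t ht
  have := (φ : StrongDual ℂ M.toStarSubalgebra).toLinearMap.norm_map_star_mul_sq_le hφ
    (s * star x) s
  simp only [ContinuousLinearMap.coe_coe, h, Complex.zero_re, mul_zero, star_mul, star_star,
    mul_assoc] at this
  simpa using le_antisymm this (by positivity)

theorem norm_eq (hφ : IsPositiveForm φ) :
    ‖φ‖ = ((φ : StrongDual ℂ M.toStarSubalgebra) 1).re := by
  have h1 : 0 ≤ ((φ : StrongDual ℂ M.toStarSubalgebra) 1).re := by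
    simpa using (Complex.nonneg_iff.1 (hφ 1)).1
  apply le_antisymm
  · refine ContinuousLinearMap.opNorm_le_of_unit_norm h1 fun x hx => ?_
    have hcs := (φ : StrongDual ℂ M.toStarSubalgebra).toLinearMap.norm_map_star_mul_sq_le hφ 1 x
    have hle := (Complex.nonneg_iff.1
      (hφ.apply_nonneg (isPositive_one_sub_star_mul_self x hx.le))).1
    simp only [ContinuousLinearMap.coe_coe, star_one, one_mul, map_sub, Complex.sub_re] at hcs hle
    refine (pow_le_pow_iff_left₀ (norm_nonneg _) h1 two_ne_zero).1 (hcs.trans ?_)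
    rw [sq]
    exact mul_le_mul_of_nonneg_left (sub_nonneg.1 hle) h1
  · refine (Complex.re_le_norm _).trans ?_
    refine ((φ : StrongDual ℂ M.toStarSubalgebra).le_opNorm 1).trans ?_
    have : ‖(1 : M.toStarSubalgebra)‖ ≤ 1 := ContinuousLinearMap.norm_id_le
    exact mul_le_of_le_one_right (norm_nonneg _) this

end IsPositiveForm

end VonNeumannAlgebra

/-! ### Compactness of the set of POVMs -/

namespace VonNeumannAlgebra

variable {H : Type*} [NormedAddCommGroup H] [InnerProductSpace ℂ H] [CompleteSpace H]

/-- Compactness of the unit ball of `B(H)` in the weak operator topology: along an ultrafilter,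
the matrix coefficients of contractions converge to those of an operator. -/
theorem exists_weak_limit {ι : Type*} (F : Ultrafilter ι) (a : ι → H →L[ℂ] H)
    (ha : ∀ k, ‖a k‖ ≤ 1) :
    ∃ T : H →L[ℂ] H, ∀ ξ η : H, Tendsto (fun k => inner ℂ (a k ξ) η) F (𝓝 (inner ℂ (T ξ) η)) := by
  have bound (ξ η : H) (k : ι) : ‖inner ℂ (a k ξ) η‖ ≤ 1 * ‖ξ‖ * ‖η‖ :=
    (norm_inner_le_norm _ _).trans
      (mul_le_mul_of_nonneg_right ((a k).le_of_opNorm_le (ha k) ξ) (norm_nonneg _))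
  have lim (ξ η : H) : ∃ l : ℂ, ‖l‖ ≤ 1 * ‖ξ‖ * ‖η‖ ∧
      Tendsto (fun k => inner ℂ (a k ξ) η) F (𝓝 l) := by
    obtain ⟨l, hl, h⟩ := isCompact_iff_ultrafilter_le_nhds.1
      (isCompact_closedBall (0 : ℂ) (1 * ‖ξ‖ * ‖η‖)) (F.map fun k => inner ℂ (a k ξ) η)
      (le_principal_iff.2 (Ultrafilter.mem_map.2 (univ_mem' fun k => by simpa using bound ξ η k)))
    exact ⟨l, by simpa using hl, h⟩
  choose L hL hlim using lim
  let B : H →ₗ⋆[ℂ] H →ₗ[ℂ] ℂ := LinearMap.mk₂'ₛₗ _ _ L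
    (fun ξ ξ' η => tendsto_nhds_unique (hlim _ _)
      (by simpa [inner_add_left] using (hlim ξ η).add (hlim ξ' η)))
    (fun c ξ η => tendsto_nhds_unique (hlim _ _)
      (by simpa [inner_smul_left, mul_comm] using (hlim ξ η).const_mul (starRingEnd ℂ c)))
    (fun ξ η η' => tendsto_nhds_unique (hlim _ _)
      (by simpa [inner_add_right] using (hlim ξ η).add (hlim ξ η')))
    (fun c ξ η => tendsto_nhds_unique (hlim _ _)
      (by simpa [inner_smul_right] using (hlim ξ η).const_mul c))
  refine ⟨InnerProductSpace.continuousLinearMapOfBilin (B.mkContinuous₂ 1 hL), fun ξ η => ?_⟩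
  rw [InnerProductSpace.continuousLinearMapOfBilin_apply]
  exact hlim ξ η

/-- On bounded sets of `M`, weak operator convergence implies convergence of every ultraweakly
continuous form. -/
theorem tendsto_predual_of_tendsto_inner {M : VonNeumannAlgebra H} {ι : Type*} {F : Filter ι}
    {a : ι → M.toStarSubalgebra} (ha : ∀ k, ‖a k‖ ≤ 1) {b : M.toStarSubalgebra}
    (h : ∀ ξ η : H, Tendsto (fun k => inner ℂ ((a k : H →L[ℂ] H) ξ) η) F
      (𝓝 (inner ℂ ((b : H →L[ℂ] H) ξ) η))) (φ : M.predual) :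
    Tendsto (fun k => (φ : StrongDual ℂ M.toStarSubalgebra) (a k)) F
      (𝓝 ((φ : StrongDual ℂ M.toStarSubalgebra) b)) := by
  have hab : Tendsto a F (@nhds _ M.ultraweakTopology b) := by
    simp only [nhds_iInf, nhds_induced, tendsto_iInf, tendsto_comap_iff]
    intro ξ η hs
    refine tendsto_tsum_of_dominated_convergence hs (fun k => ?_)
      (Eventually.of_forall fun j k => ?_)
    · simpa [Function.comp_def] using (h (ξ k) (η k)).star
    · calc ‖inner ℂ (η k) ((a j : H →L[ℂ] H) (ξ k))‖
          ≤ ‖η k‖ * ‖(a j : H →L[ℂ] H) (ξ k)‖ := norm_inner_le_norm _ _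
        _ ≤ ‖η k‖ * (1 * ‖ξ k‖) := by
            gcongr
            exact (a j : H →L[ℂ] H).le_of_opNorm_le (ha j) _
        _ = ‖ξ k‖ * ‖η k‖ := by ring
  have hφ : Continuous[M.ultraweakTopology, inferInstance]
      (φ : StrongDual ℂ M.toStarSubalgebra) := φ.2
  exact (@Continuous.tendsto _ _ M.ultraweakTopology _ _ hφ b).comp hab

namespace IsPOVM

variable {M : VonNeumannAlgebra H} {n : ℕ}

theorem norm_le_one {t : Fin n → M.toStarSubalgebra} (ht : IsPOVM t) (i : Fin n) :
    ‖t i‖ ≤ 1 := by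
  refine (CStarAlgebra.norm_le_one_iff_of_nonneg (t i : H →L[ℂ] H)
    ((ContinuousLinearMap.nonneg_iff_isPositive _).2 (ht.1 i))).2 ?_
  have h : ∑ j, (t j : H →L[ℂ] H) = 1 := by
    simpa using congrArg (Subtype.val : M.toStarSubalgebra → H →L[ℂ] H) ht.2
  rw [← h]
  exact Finset.single_le_sum
    (fun j _ => (ContinuousLinearMap.nonneg_iff_isPositive _).2 (ht.1 j)) (Finset.mem_univ i)

/-- Ultraweak compactness of the set of POVMs, tested on the predual. -/
theorem exists_ultraweak_limit {ι : Type*} (F : Ultrafilter ι) {a : ι → Fin n → M.toStarSubalgebra}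
    (ha : ∀ k, IsPOVM (a k)) :
    ∃ t : Fin n → M.toStarSubalgebra, IsPOVM t ∧ ∀ (φ : M.predual) (i : Fin n),
      Tendsto (fun k => (φ : StrongDual ℂ M.toStarSubalgebra) (a k i)) F
        (𝓝 ((φ : StrongDual ℂ M.toStarSubalgebra) (t i))) := by
  choose T hT using fun i => exists_weak_limit F (fun k => (a k i : H →L[ℂ] H))
    fun k => (ha k).norm_le_one i
  have hmem (i : Fin n) : T i ∈ M.toStarSubalgebra := by
    refine M.mem_of_forall_commute fun y hy => ?_
    ext ξ
    refine ext_inner_right ℂ fun η => tendsto_nhds_unique (f := fun k =>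
      inner ℂ ((a k i : H →L[ℂ] H) ξ) (y.adjoint η)) (l := (F : Filter ι)) ?_ ?_
    · simpa [ContinuousLinearMap.adjoint_inner_right] using hT i ξ (y.adjoint η)
    · refine (hT i (y ξ) η).congr fun k => ?_
      rw [ContinuousLinearMap.adjoint_inner_right]
      have hc : (a k i : H →L[ℂ] H) * y = y * a k i := mem_commutant_iff.1 hy _ (a k i).2
      exact congrArg (fun S : H →L[ℂ] H => inner ℂ (S ξ) η) hc
  refine ⟨fun i => ⟨T i, hmem i⟩, ⟨fun i => ?_, Subtype.ext ?_⟩, fun φ i =>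
    tendsto_predual_of_tendsto_inner (fun k => (ha k).norm_le_one i) (hT i) φ⟩
  · refine (ContinuousLinearMap.isPositive_iff_complex (T i)).2 fun ξ => ?_
    have h : 0 ≤ inner ℂ (T i ξ) ξ :=
      ge_of_tendsto' (hT i ξ ξ) fun k => ((ha k).1 i).inner_nonneg_left ξ
    obtain ⟨hre, him⟩ := Complex.nonneg_iff.1 h
    exact ⟨Complex.ext (by simp) (by simpa using him), hre⟩
  · have hsum : ∑ i, T i = 1 := by
      ext ξ
      refine ext_inner_right ℂ fun η => ?_
      have hl := tendsto_finsetSum Finset.univ fun i _ => hT i ξ η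
      have hc (k : ι) : ∑ i, inner ℂ ((a k i : H →L[ℂ] H) ξ) η = inner ℂ ξ η := by
        have h : ∑ i, (a k i : H →L[ℂ] H) = 1 := by
          simpa using congrArg (Subtype.val : M.toStarSubalgebra → H →L[ℂ] H) (ha k).2
        rw [← sum_inner, ← sum_apply, h, one_apply_eq_self]
      simp only [hc] at hl
      rw [sum_apply, sum_inner]
      exact tendsto_nhds_unique hl tendsto_const_nhds
    simpa using hsum

/-- The supremum of `∑ᵢ φᵢ(tᵢ)` over all POVMs is attained, at an ultraweak limit of a maximizing
sequence. -/
theorem exists_isMax (hn : 1 ≤ n) (φ : Fin n → M.predual) :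
    ∃ t : Fin n → M.toStarSubalgebra, IsPOVM t ∧ ∀ s : Fin n → M.toStarSubalgebra, IsPOVM s →
      ∑ i, ((φ i : StrongDual ℂ M.toStarSubalgebra) (s i)).re ≤
        ∑ i, ((φ i : StrongDual ℂ M.toStarSubalgebra) (t i)).re := by
  let S : Set ℝ := (fun s : Fin n → M.toStarSubalgebra =>
    ∑ i, ((φ i : StrongDual ℂ M.toStarSubalgebra) (s i)).re) '' {s | IsPOVM s}
  have hne : S.Nonempty := by
    refine Set.Nonempty.image _ ⟨Pi.single ⟨0, hn⟩ 1, fun i => ?_, by simp⟩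
    by_cases hi : i = ⟨0, hn⟩
    · subst hi
      simp
    · simp [Pi.single_eq_of_ne hi]
  have hbdd : BddAbove S := by
    refine ⟨∑ i, ‖φ i‖, ?_⟩
    rintro _ ⟨s, hs, rfl⟩
    refine Finset.sum_le_sum fun i _ => (Complex.re_le_norm _).trans ?_
    simpa using (φ i : StrongDual ℂ M.toStarSubalgebra).le_opNorm_of_le (hs.norm_le_one i)
  obtain ⟨u, -, hu, huS⟩ := exists_seq_tendsto_sSup hne hbdd
  choose a ha hau using huS
  obtain ⟨t, ht, hlim⟩ := exists_ultraweak_limit (hyperfilter ℕ) ha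
  have hl := tendsto_finsetSum Finset.univ fun i _ =>
    (Complex.continuous_re.tendsto _).comp (hlim (φ i) i)
  have heq := tendsto_nhds_unique hl
    ((hu.mono_left Nat.hyperfilter_le_atTop).congr fun k => (hau k).symm)
  exact ⟨t, ht, fun s hs => (le_csSup hbdd ⟨s, hs, rfl⟩).trans heq.ge⟩

end IsPOVM

end VonNeumannAlgebra

/-! ### The first-order optimality condition -/

namespace VonNeumannAlgebra

variable {H : Type*} [NormedAddCommGroup H] [InnerProductSpace ℂ H] [CompleteSpace H]
  {M : VonNeumannAlgebra H} {n : ℕ}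

theorem sum_lmul_apply (t : Fin n → M.toStarSubalgebra) (φ : Fin n → M.predual)
    (x : M.toStarSubalgebra) :
    ((∑ i, lmul (t i) (φ i) : M.predual) : StrongDual ℂ M.toStarSubalgebra) x =
      ∑ i, (φ i : StrongDual ℂ M.toStarSubalgebra) (x * t i) := by
  rw [Submodule.coe_sum, sum_apply]
  rfl

theorem IsPositiveForm.of_norm_le_one {φ : M.predual}
    (h : ∀ x : M.toStarSubalgebra, ‖x‖ ≤ 1 →
      0 ≤ (φ : StrongDual ℂ M.toStarSubalgebra) (star x * x)) : IsPositiveForm φ := by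
  intro x
  by_cases hx : x = 0
  · simp [hx]
  have hx' : 0 < ‖x‖ := norm_pos_iff.2 hx
  have hle : ‖((‖x‖⁻¹ : ℝ) : ℂ) • x‖ ≤ 1 := by
    rw [norm_smul, Complex.norm_real, norm_inv, norm_norm, inv_mul_cancel₀ hx'.ne']
  have := h _ hle
  simp only [star_smul, smul_mul_assoc, mul_smul_comm, map_smul, smul_eq_mul, ← mul_assoc] at this
  refine le_of_mul_le_mul_left (a := ((‖x‖⁻¹ : ℝ) : ℂ) * ((‖x‖⁻¹ : ℝ) : ℂ)) ?_ ?_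
  · simpa [mul_assoc] using this
  · rw [← Complex.ofReal_mul]
    exact_mod_cast mul_pos (inv_pos.2 hx') (inv_pos.2 hx')

/-- For `w = 1 - c x* x`, the identity
`1 - w* w = (2 Re c - |c|²) x* x + |c|² x* (1 - x x*) x` exhibits `1 - w* w` as a sum of positive
operators. -/
theorem isPositive_one_sub_star_mul_self_of_normSq_le {x : M.toStarSubalgebra} (hx : ‖x‖ ≤ 1)
    {c : ℂ} (hc : Complex.normSq c ≤ 2 * c.re) :
    ((1 - star (1 - c • (star x * x)) * (1 - c • (star x * x)) : M.toStarSubalgebra) :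
      H →L[ℂ] H).IsPositive := by
  have key : (1 - star (1 - c • (star x * x)) * (1 - c • (star x * x)) : M.toStarSubalgebra) =
      ((2 * c.re - Complex.normSq c : ℝ) : ℂ) • (star x * x) +
        (Complex.normSq c : ℂ) • (star x * (1 - star (star x) * star x) * x) := by
    have h2 : ((2 * c.re - Complex.normSq c : ℝ) : ℂ) = c + star c - star c * c := by
      have := Complex.normSq_eq_conj_mul_self (z := c)
      have h3 := Complex.add_conj c
      simp only [Complex.star_def, ← this, h3]
      push_cast
      ring
    rw [h2, Complex.normSq_eq_conj_mul_self]
    simp only [star_sub, star_one, star_smul, star_mul, star_star, sub_mul, mul_sub, one_mul,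
      mul_one, smul_mul_assoc, mul_smul_comm, smul_smul, mul_assoc, smul_sub, add_smul, sub_smul,
      Complex.star_def, mul_comm c]
    abel
  rw [key]
  refine ContinuousLinearMap.IsPositive.add ?_ ?_
  · exact (isPositive_star_mul_self x).smul_of_nonneg
      (Complex.zero_le_real.2 (sub_nonneg.2 hc))
  · refine ContinuousLinearMap.IsPositive.smul_of_nonneg ?_
      (Complex.zero_le_real.2 (Complex.normSq_nonneg c))
    exact (isPositive_one_sub_star_mul_self (star x) ((norm_star x).trans_le hx)).adjoint_conj
      (x : H →L[ℂ] H)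

/-- Compressing a POVM by `w` with `w* w ≤ 1`, and assigning the defect `1 - w* w` to the outcome
`j`, gives a POVM. -/
theorem IsPOVM.compress {t : Fin n → M.toStarSubalgebra} (ht : IsPOVM t) {w : M.toStarSubalgebra}
    (hw : ((1 - star w * w : M.toStarSubalgebra) : H →L[ℂ] H).IsPositive) (j : Fin n) :
    IsPOVM fun i => star w * t i * w +
      (Pi.single j (1 - star w * w) : Fin n → M.toStarSubalgebra) i := by
  constructor
  · intro i
    refine ContinuousLinearMap.IsPositive.add ((ht.1 i).adjoint_conj (w : H →L[ℂ] H)) ?_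
    by_cases hi : i = j
    · subst hi
      simpa using hw
    · simp [Pi.single_eq_of_ne hi]
  · rw [Finset.sum_add_distrib, ← Finset.sum_mul, ← Finset.mul_sum, ht.2,
      Finset.sum_pi_single' j (1 - star w * w)]
    simp

theorem star_one_sub_smul_mul_mul {h : M.toStarSubalgebra} (hsa : star h = h)
    (t : M.toStarSubalgebra) (c : ℂ) :
    star (1 - c • h) * t * (1 - c • h) =
      t - c • (t * h) - star c • (h * t) + (star c * c) • (h * t * h) := by
  simp only [star_sub, star_one, star_smul, hsa, sub_mul, mul_sub, one_mul, mul_one,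
    smul_mul_assoc, mul_smul_comm, smul_sub, mul_smul, smul_comm c (star c)]
  abel

/-- Lower bound for `φ` on the compression of a positive `t` by `1 - ε (1 + i κ) h`: the quadratic
term `φ (h t h)` is nonnegative and is dropped. -/
theorem IsPositiveForm.le_re_apply_compress {φ : M.predual} (hφ : IsPositiveForm φ)
    {t : M.toStarSubalgebra} (ht : (t : H →L[ℂ] H).IsPositive) {h : M.toStarSubalgebra}
    (hsa : star h = h) (ε κ : ℝ) :
    ((φ : StrongDual ℂ M.toStarSubalgebra) t).re -
        2 * ε * (((φ : StrongDual ℂ M.toStarSubalgebra) (h * t)).re +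
          κ * ((φ : StrongDual ℂ M.toStarSubalgebra) (h * t)).im) ≤
      ((φ : StrongDual ℂ M.toStarSubalgebra)
        (star (1 - (⟨ε, ε * κ⟩ : ℂ) • h) * t * (1 - (⟨ε, ε * κ⟩ : ℂ) • h))).re := by
  have hst : star t = t := Subtype.ext ht.isSelfAdjoint.star_eq
  have hconj : (φ : StrongDual ℂ M.toStarSubalgebra) (t * h) =
      star ((φ : StrongDual ℂ M.toStarSubalgebra) (h * t)) := by
    rw [← hφ.map_star, star_mul, hsa, hst]
  have hp : ((h * t * h : M.toStarSubalgebra) : H →L[ℂ] H).IsPositive := by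
    have := ht.adjoint_conj (h : H →L[ℂ] H)
    have he : (h : H →L[ℂ] H).adjoint = h := congrArg Subtype.val hsa
    rw [he] at this
    exact this
  have hquad := (Complex.nonneg_iff.1 (hφ.apply_nonneg hp)).1
  rw [star_one_sub_smul_mul_mul hsa]
  simp only [map_add, map_sub, map_smul, smul_eq_mul, hconj]
  generalize (φ : StrongDual ℂ M.toStarSubalgebra) (h * t * h) = q at hquad ⊢
  generalize (φ : StrongDual ℂ M.toStarSubalgebra) (h * t) = p
  simp only [Complex.add_re, Complex.sub_re, Complex.mul_re, Complex.mul_im, Complex.star_def,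
    Complex.conj_re, Complex.conj_im]
  linarith [mul_nonneg (add_nonneg (mul_self_nonneg ε) (mul_self_nonneg (ε * κ))) hquad]

theorem re_apply_defect (φ : M.predual) {h : M.toStarSubalgebra} (hsa : star h = h) (ε κ : ℝ) :
    ((φ : StrongDual ℂ M.toStarSubalgebra)
        (1 - star (1 - (⟨ε, ε * κ⟩ : ℂ) • h) * (1 - (⟨ε, ε * κ⟩ : ℂ) • h))).re =
      2 * ε * ((φ : StrongDual ℂ M.toStarSubalgebra) h).re -
        ε * (ε * ((1 + κ ^ 2) * ((φ : StrongDual ℂ M.toStarSubalgebra) (h * h)).re)) := by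
  have := star_one_sub_smul_mul_mul hsa 1 ⟨ε, ε * κ⟩
  rw [mul_one, mul_one, one_mul] at this
  rw [this]
  simp only [map_add, map_sub, map_smul, smul_eq_mul]
  generalize (φ : StrongDual ℂ M.toStarSubalgebra) (h * h) = q
  generalize (φ : StrongDual ℂ M.toStarSubalgebra) h = p
  simp only [Complex.add_re, Complex.sub_re, Complex.mul_re, Complex.mul_im, Complex.star_def,
    Complex.conj_re, Complex.conj_im]
  ring

/-- The inequality `∑ᵢ φᵢ(tᵢ') ≤ ∑ᵢ φᵢ(tᵢ)` for the POVM `t'` obtained by compressing a maximizing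
POVM `t` by `1 - ε (1 + i κ) x* x`, divided by `ε`; here `h = x* x` and `P = ∑ᵢ φᵢ(h tᵢ)`. -/
theorem IsPOVM.first_variation_le {φ : Fin n → M.predual} (hφ : ∀ i, IsPositiveForm (φ i))
    {t : Fin n → M.toStarSubalgebra} (ht : IsPOVM t)
    (hmax : ∀ s : Fin n → M.toStarSubalgebra, IsPOVM s →
      ∑ i, ((φ i : StrongDual ℂ M.toStarSubalgebra) (s i)).re ≤
        ∑ i, ((φ i : StrongDual ℂ M.toStarSubalgebra) (t i)).re)
    (j : Fin n) {x h : M.toStarSubalgebra} (hx : ‖x‖ ≤ 1) (hh : star x * x = h) {P : ℂ}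
    (hP : ∑ i, (φ i : StrongDual ℂ M.toStarSubalgebra) (h * t i) = P)
    {ε κ : ℝ} (h0 : 0 < ε) (h1 : ε * (1 + κ ^ 2) ≤ 2) :
    2 * (((φ j : StrongDual ℂ M.toStarSubalgebra) h).re - P.re - κ * P.im) ≤
      ε * ((1 + κ ^ 2) * ((φ j : StrongDual ℂ M.toStarSubalgebra) (h * h)).re) := by
  have hsa : star h = h := by simp [← hh]
  have hnc : Complex.normSq ⟨ε, ε * κ⟩ ≤ 2 * ε := by
    rw [Complex.normSq_mk]
    nlinarith
  have hw := isPositive_one_sub_star_mul_self_of_normSq_le hx hnc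
  rw [hh] at hw
  have hm := hmax _ (ht.compress hw j)
  have hsum := Finset.sum_le_sum fun i (_ : i ∈ Finset.univ) =>
    (hφ i).le_re_apply_compress (ht.1 i) hsa ε κ
  have hdefect := re_apply_defect (φ j) hsa ε κ
  generalize (1 - (⟨ε, ε * κ⟩ : ℂ) • h) = w at hm hsum hdefect
  have hsingle : ∑ i, ((φ i : StrongDual ℂ M.toStarSubalgebra)
      ((Pi.single j (1 - star w * w) : Fin n → M.toStarSubalgebra) i)).re =
      ((φ j : StrongDual ℂ M.toStarSubalgebra) (1 - star w * w)).re := by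
    rw [Finset.sum_eq_single_of_mem j (Finset.mem_univ j), Pi.single_eq_same]
    intro i _ hi
    rw [Pi.single_eq_of_ne hi, map_zero, Complex.zero_re]
  simp only [map_add, Complex.add_re, Finset.sum_add_distrib] at hm
  rw [hsingle, hdefect] at hm
  rw [Finset.sum_sub_distrib, ← Finset.mul_sum, Finset.sum_add_distrib, ← Finset.mul_sum,
    ← Complex.re_sum Finset.univ fun i => (φ i : StrongDual ℂ M.toStarSubalgebra) (h * t i),
    ← Complex.im_sum, hP] at hsum
  refine le_of_mul_le_mul_left ?_ h0
  linarith

/-- The optimality condition for a maximizing POVM: the form `ψ = ∑ᵢ tᵢ φᵢ` is hermitian and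
majorizes all the `φⱼ`. In the limit `ε → 0`, the first variation gives
`φⱼ(h) ≤ Re ψ(h) + κ Im ψ(h)` for `h = x* x`; as `κ` is an arbitrary real number, this
means both `Im ψ(h) = 0` and `φⱼ(h) ≤ ψ(h)`. -/
theorem isMajorant_sum_lmul {φ : Fin n → M.predual} (hφ : ∀ i, IsPositiveForm (φ i))
    {t : Fin n → M.toStarSubalgebra} (ht : IsPOVM t)
    (hmax : ∀ s : Fin n → M.toStarSubalgebra, IsPOVM s →
      ∑ i, ((φ i : StrongDual ℂ M.toStarSubalgebra) (s i)).re ≤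
        ∑ i, ((φ i : StrongDual ℂ M.toStarSubalgebra) (t i)).re) :
    IsMajorant φ (∑ i, lmul (t i) (φ i)) := by
  intro j
  refine IsPositiveForm.of_norm_le_one fun x hx => ?_
  change 0 ≤ ((∑ i, lmul (t i) (φ i) : M.predual) : StrongDual ℂ M.toStarSubalgebra) (star x * x) -
    (φ j : StrongDual ℂ M.toStarSubalgebra) (star x * x)
  rw [sum_lmul_apply]
  have hφj := (Complex.nonneg_iff.1 (hφ j x)).2
  have hvar (ε κ : ℝ) := ht.first_variation_le hφ hmax j (ε := ε) (κ := κ) hx rfl rfl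
  generalize ∑ i, (φ i : StrongDual ℂ M.toStarSubalgebra) (star x * x * t i) = P at hvar ⊢
  generalize (φ j : StrongDual ℂ M.toStarSubalgebra) (star x * x) = p at hvar hφj ⊢
  generalize ((φ j : StrongDual ℂ M.toStarSubalgebra) (star x * x * (star x * x))).re = q at hvar
  have first_order (κ : ℝ) : p.re - P.re ≤ κ * P.im := by
    have hκ : 0 < 1 + κ ^ 2 := by positivity
    have hlim : Tendsto (fun ε : ℝ => ε * ((1 + κ ^ 2) * q)) (𝓝[>] 0)
        (𝓝 (0 * ((1 + κ ^ 2) * q))) :=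
      (tendsto_id.mono_left nhdsWithin_le_nhds).mul_const _
    have hev : ∀ᶠ ε : ℝ in 𝓝[>] 0, 2 * (p.re - P.re - κ * P.im) ≤ ε * ((1 + κ ^ 2) * q) := by
      filter_upwards [Ioo_mem_nhdsGT (show (0 : ℝ) < 2 / (1 + κ ^ 2) by positivity)] with ε h
      exact hvar ε κ h.1 ((lt_div_iff₀ hκ).1 h.2).le
    linarith [ge_of_tendsto hlim hev]
  have him : P.im = 0 := by
    by_contra hne
    have := first_order ((p.re - P.re - 1) / P.im)
    rw [div_mul_cancel₀ _ hne] at this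
    linarith
  have hre := first_order 0
  rw [Complex.nonneg_iff, Complex.sub_re, Complex.sub_im, him, ← hφj]
  exact ⟨by linarith, by simp⟩

/-! ### Weak duality and the minimal majorant -/

theorem IsMajorant.isPositiveForm {φ : Fin n → M.predual} (hφ : ∀ i, IsPositiveForm (φ i))
    {ψ : M.predual} (h : IsMajorant φ ψ) (i : Fin n) : IsPositiveForm ψ := by
  intro x
  have h1 : 0 ≤ (ψ : StrongDual ℂ M.toStarSubalgebra) (star x * x) -
    (φ i : StrongDual ℂ M.toStarSubalgebra) (star x * x) := h i x
  exact (hφ i x).trans (sub_nonneg.1 h1)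

/-- Weak duality for a majorant `ψ` and a POVM `t`: `ψ(1) - ∑ᵢ φᵢ(tᵢ) = ∑ᵢ (ψ - φᵢ)(tᵢ)`, a sum of
nonnegative terms. -/
theorem IsPOVM.re_apply_one_sub {t : Fin n → M.toStarSubalgebra} (ht : IsPOVM t)
    (φ : Fin n → M.predual) (ψ : M.predual) :
    ((ψ : StrongDual ℂ M.toStarSubalgebra) 1).re -
        ∑ i, ((φ i : StrongDual ℂ M.toStarSubalgebra) (t i)).re =
      ∑ i, (((ψ - φ i : M.predual) : StrongDual ℂ M.toStarSubalgebra) (t i)).re := by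
  rw [← ht.2, map_sum, Complex.re_sum, ← Finset.sum_sub_distrib]
  rfl

end VonNeumannAlgebra

open VonNeumannAlgebra in
theorem corollary7p2 {H : Type*} [NormedAddCommGroup H] [InnerProductSpace ℂ H] [CompleteSpace H]
    (M : VonNeumannAlgebra H) (n : ℕ) (hn : 1 ≤ n) (φ : Fin n → M.predual)
    (hφ : ∀ i, VonNeumannAlgebra.IsPositiveForm (φ i)) :
    (∃! ψ : M.predual, VonNeumannAlgebra.IsMinimalMajorant φ ψ) ∧
      ∀ ψ : M.predual, VonNeumannAlgebra.IsMinimalMajorant φ ψ →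
        ∃ t : Fin n → M.toStarSubalgebra, VonNeumannAlgebra.IsPOVM t ∧
          ψ = ∑ i, VonNeumannAlgebra.lmul (t i) (φ i) := by
  obtain ⟨t, ht, hmax⟩ := IsPOVM.exists_isMax hn φ
  have hψ₀ := isMajorant_sum_lmul hφ ht hmax
  set ψ₀ := ∑ i, lmul (t i) (φ i) with hψ₀_def
  have hterm {ψ : M.predual} (hψ : IsMajorant φ ψ) (i : Fin n) :=
    Complex.nonneg_iff.1 ((hψ i).apply_nonneg (ht.1 i))
  have hnorm₀ : ‖ψ₀‖ = ∑ i, ((φ i : StrongDual ℂ M.toStarSubalgebra) (t i)).re := by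
    rw [(hψ₀.isPositiveForm hφ ⟨0, hn⟩).norm_eq, hψ₀_def, sum_lmul_apply, Complex.re_sum]
    simp
  have hmin : IsMinimalMajorant φ ψ₀ := by
    refine ⟨hψ₀, fun ψ hψ => ?_⟩
    rw [hnorm₀, (hψ.isPositiveForm hφ ⟨0, hn⟩).norm_eq, ← sub_nonneg, ht.re_apply_one_sub]
    exact Finset.sum_nonneg fun i _ => (hterm hψ i).1
  -- a minimal majorant attains equality in weak duality, hence `ψ - φ i` vanishes at `t i`
  have huniq (ψ : M.predual) (hψ : IsMinimalMajorant φ ψ) : ψ = ψ₀ := by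
    have hsum := ht.re_apply_one_sub φ ψ
    rw [← (hψ.1.isPositiveForm hφ ⟨0, hn⟩).norm_eq,
      le_antisymm (hψ.2 ψ₀ hψ₀) (hmin.2 ψ hψ.1), hnorm₀, sub_self] at hsum
    have hzero (i : Fin n) :
        ((ψ - φ i : M.predual) : StrongDual ℂ M.toStarSubalgebra) (t i) = 0 :=
      Complex.ext ((Finset.sum_eq_zero_iff_of_nonneg fun i _ => (hterm hψ.1 i).1).1 hsum.symm i
        (Finset.mem_univ i)) (hterm hψ.1 i).2.symm
    refine Subtype.ext (ContinuousLinearMap.ext fun x => ?_)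
    have hx (i : Fin n) : (ψ : StrongDual ℂ M.toStarSubalgebra) (x * t i) =
        (φ i : StrongDual ℂ M.toStarSubalgebra) (x * t i) :=
      sub_eq_zero.1 ((hψ.1 i).apply_mul_eq_zero (ht.1 i) (hzero i) x)
    rw [hψ₀_def, sum_lmul_apply, ← Finset.sum_congr rfl fun i _ => hx i, ← map_sum,
      ← Finset.mul_sum, ht.2, mul_one]
  exact ⟨⟨ψ₀, hmin, huniq⟩, fun ψ hψ => ⟨t, ht, huniq ψ hψ⟩⟩
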